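/- Let $G=Sp(2)$ be the group of unitary quaternionic $2\times2$-matrices, with Lie algebra $\mathfrak g=\mathfrak{sp}(2)=\{X\in\mathbb H^{2\times 2}: X^*=-X\}$, and let $K=Sp(1)\times Sp(1)$ (diagonal matrices) and $H=\Delta Sp(1)=\{\mathrm{diag}(q,q)\}\subset K$. Start with the bi-invariant metric $\langle X,Y\rangle=\mathrm{Re}\,\mathrm{trace}(X^*Y)$ and write $\mathfrak g=\mathfrak p\oplus\mathfrak q\oplus\mathfrak h$ orthogonally, where $\mathfrak h=\{\mathrm{diag}(v,v)\}$, $\mathfrak q=\{\mathrm{diag}(v,-v)\}$ ($v\in\mathrm{Im}\,\mathbb H$), $\mathfrak k=\mathfrak q\oplus\mathfrak h$, and $\mathfrak p$ consists of the matrices in $\mathfrak g$ with zero diagonal. For $s,t>0$ let $\langle\ ,\ \rangle_2$ be the left-invariant metric on $G$ obtained from $\langle\ ,\ \rangle$ by Cheeger contraction along $K$ with parameter $s$ followed by Cheeger contraction along $H$ with parameter $t$, i.e. $$\langle X,Y\rangle_2=\langle X_{\mathfrak p},Y_{\mathfrak p}\rangle+\tfrac{s}{s+1}\langle X_{\mathfrak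 q},Y_{\mathfrak q}\rangle+\tfrac{s}{s+1}\,\tfrac{t}{t+1}\langle X_{\mathfrak h},Y_{\mathfrak h}\rangle ,$$ and for $X\in\mathfrak g$ put $\tilde X=X_{\mathfrak p}+X_{\mathfrak q}+\frac{t}{t+1}X_{\mathfrak h}$. Then a two-dimensional subspace $\sigma\subset\mathfrak g=T_eG$ has zero sectional curvature with respect to $\langle\ ,\ \rangle_2$ if and only if $\sigma$ is spanned by some $X,Y\in\mathfrak g$ for which $\tilde X,\tilde Y$ have one of the following forms, where $x,y\in\mathbb H$ are nonzero and $y$ is purely imaginary: (XY1) $\tilde X=\begin{pmatrix}0&0\\0&y\end{pmatrix}$, $\tilde Y=\begin{pmatrix}y&0\\0&0\end{pmatrix}$; (XY2) $\tilde X=\begin{pmatrix}0&-\bar x\\x&0\end{pmatrix}$, $\tilde Y=\begin{pmatrix}y&0\\0&xyx^{-1}\end{pmatrix}$; (XY3) $\tilde X=X_\pm=\begin{pmatrix}y&-\bar x\\x&\mp y\end{pmatrix}$, $\tilde Y=Y_\pm=\begin{pmatrix}y&0\\0&\pm y\end{pmatrix}$, with $xyx^{-1}=\pm y$ (the same choice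 of sign throughout). -/

import Mathlib

open scoped Quaternion Matrix

/- Square matrices carry the commutator bracket. -/
attribute [local instance 100] LieRing.ofAssociativeRing

noncomputable section

/-! ### Curvature of a left-invariant metric

A left-invariant metric on a Lie group is an inner product `B` on its Lie algebra `g`. Its
Levi-Civita connection and its curvature tensor are left-invariant, and on left-invariant vector
fields (elements of `g`) they are given by the algebraic definitions below. -/

section LeftInvariant

variable {g : Type*} [LieRing g] [LieAlgebra ℝ g] [FiniteDimensional ℝ g]

/-- The Levi-Civita connection `∇_X Y` on left-invariant fields, given by the Koszul formula
`2 B(∇_X Y, Z) = B([X,Y],Z) - B([Y,Z],X) + B([Z,X],Y)`. -/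
def leviCivita (B : LinearMap.BilinForm ℝ g) (hB : B.Nondegenerate) (X Y : g) : g :=
  (B.toDual hB).symm ((1 / 2 : ℝ) •
    (B ⁅X, Y⁆ - (B.flip X).comp (LieAlgebra.ad ℝ g Y)
      - (B.flip Y).comp (LieAlgebra.ad ℝ g X)))

theorem leviCivita_koszul (B : LinearMap.BilinForm ℝ g) (hB : B.Nondegenerate) (X Y Z : g) :
    2 * B (leviCivita B hB X Y) Z = B ⁅X, Y⁆ Z - B ⁅Y, Z⁆ X + B ⁅Z, X⁆ Y := by
  unfold leviCivita
  have e : B ⁅Z, X⁆ Y = -B ⁅X, Z⁆ Y := by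
    rw [← lie_skew Z X, map_neg, LinearMap.neg_apply]
  rw [LinearMap.BilinForm.apply_toDual_symm_apply, e]
  simp
  ring

/-- The connection is torsion-free. -/
theorem leviCivita_torsion_free (B : LinearMap.BilinForm ℝ g) (hB : B.Nondegenerate) (X Y : g) :
    leviCivita B hB X Y - leviCivita B hB Y X = ⁅X, Y⁆ := by
  apply (B.toDual hB).injective
  ext Z
  have h1 := leviCivita_koszul B hB X Y Z
  have h2 := leviCivita_koszul B hB Y X Z
  have e (U V W : g) : B ⁅U, V⁆ W = -B ⁅V, U⁆ W := by
    rw [← lie_skew U V, map_neg, LinearMap.neg_apply]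
  rw [e Y X, e X Z, e Z Y] at h2
  simp only [LinearMap.BilinForm.toDual_def, map_sub, LinearMap.sub_apply]
  linarith

/-- The connection is compatible with the metric. -/
theorem leviCivita_metric (B : LinearMap.BilinForm ℝ g) (hB : B.Nondegenerate) (hs : B.IsSymm)
    (X Y Z : g) : B (leviCivita B hB X Y) Z + B Y (leviCivita B hB X Z) = 0 := by
  have h1 := leviCivita_koszul B hB X Y Z
  have h2 := leviCivita_koszul B hB X Z Y
  have h3 : B Y (leviCivita B hB X Z) = B (leviCivita B hB X Z) Y := by
    simpa using hs.eq Y (leviCivita B hB X Z)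
  have e (U V W : g) : B ⁅U, V⁆ W = -B ⁅V, U⁆ W := by
    rw [← lie_skew U V, map_neg, LinearMap.neg_apply]
  rw [e X Z, e Z Y, e Y X] at h2
  rw [h3]
  linarith

/-- The curvature tensor `R(X,Y)Z = ∇_X ∇_Y Z - ∇_Y ∇_X Z - ∇_[X,Y] Z`. -/
def curvatureTensor (B : LinearMap.BilinForm ℝ g) (hB : B.Nondegenerate) (X Y Z : g) : g :=
  leviCivita B hB X (leviCivita B hB Y Z) - leviCivita B hB Y (leviCivita B hB X Z)
    - leviCivita B hB ⁅X, Y⁆ Z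

/-- The sectional curvature `⟨R(X,Y)Y,X⟩ / |X ∧ Y|²` of the plane spanned by `X`, `Y`. -/
def sectionalCurvature (B : LinearMap.BilinForm ℝ g) (hB : B.Nondegenerate) (X Y : g) : ℝ :=
  B (curvatureTensor B hB X Y Y) X / (B X X * B Y Y - B X Y ^ 2)

/-- `σ` is a plane of zero sectional curvature. -/
def IsZeroCurvaturePlane (B : LinearMap.BilinForm ℝ g) (hB : B.Nondegenerate)
    (σ : Submodule ℝ g) : Prop :=
  Module.finrank ℝ σ = 2 ∧
    ∀ X Y : g, Submodule.span ℝ {X, Y} = σ → sectionalCurvature B hB X Y = 0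

end LeftInvariant

section Cheeger

variable {g : Type*} [AddCommGroup g] [Module ℝ g]

/-- The inner product of the Cheeger contraction, with parameter `s`, of the left-invariant metric
`B` along a subgroup, where `P` is the `B`-orthogonal projection onto the Lie algebra of the
subgroup: `⟨X_⊥, Y_⊥⟩ + s/(s+1) ⟨X_𝔨, Y_𝔨⟩`. -/
def cheegerContraction (B : LinearMap.BilinForm ℝ g) (P : g →ₗ[ℝ] g) (s : ℝ) :
    LinearMap.BilinForm ℝ g :=
  B.compl₁₂ (LinearMap.id - P) (LinearMap.id - P) + (s / (s + 1)) • B.compl₁₂ P P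

/-- The vector `X̃ = X_⊥ + s/(s+1) X_𝔨` associated with `X` by a Cheeger contraction. -/
def cheegerTilde (P : g →ₗ[ℝ] g) (s : ℝ) (X : g) : g := (X - P X) + (s / (s + 1)) • P X

theorem cheegerContraction_isSymm {B : LinearMap.BilinForm ℝ g} (hB : B.IsSymm) (P : g →ₗ[ℝ] g)
    (s : ℝ) : (cheegerContraction B P s).IsSymm := by
  refine ⟨fun X Y => ?_⟩
  have h (U V : g) : B U V = B V U := by simpa using hB.eq U V
  change B (X - P X) (Y - P Y) + s / (s + 1) * B (P X) (P Y)
    = B (Y - P Y) (X - P X) + s / (s + 1) * B (P Y) (P X)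
  rw [h (X - P X), h (P X)]

theorem cheegerContraction_pos {B : LinearMap.BilinForm ℝ g} (hB : ∀ X, X ≠ 0 → 0 < B X X)
    (P : g →ₗ[ℝ] g) {s : ℝ} (hs : 0 < s) (X : g) (hX : X ≠ 0) :
    0 < cheegerContraction B P s X X := by
  have h0 (Y : g) : 0 ≤ B Y Y := by
    by_cases h : Y = 0
    · simp [h]
    · exact (hB Y h).le
  have hc : 0 < s / (s + 1) := by positivity
  have e : cheegerContraction B P s X X
      = B (X - P X) (X - P X) + s / (s + 1) * B (P X) (P X) := rfl
  rw [e]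
  by_cases h : P X = 0
  · simpa [h] using hB X hX
  · exact add_pos_of_nonneg_of_pos (h0 _) (mul_pos hc (hB _ h))

end Cheeger

/-! ### The Lie algebra `𝔰𝔭(2)` and its metrics -/

theorem conjTranspose_real_smul (c : ℝ) (X : Matrix (Fin 2) (Fin 2) ℍ[ℝ]) :
    (c • X)ᴴ = c • Xᴴ := by
  ext i j : 1
  simp [Matrix.conjTranspose_apply]

/-- `𝔰𝔭(2)`, the Lie algebra of `Sp(2)`: quaternionic `2 × 2` matrices with `X* = -X`. -/
def sp2 : LieSubalgebra ℝ (Matrix (Fin 2) (Fin 2) ℍ[ℝ]) where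
  carrier := {X | Xᴴ = -X}
  add_mem' {X Y} hX hY := by
    change Xᴴ = -X at hX
    change Yᴴ = -Y at hY
    change (X + Y)ᴴ = -(X + Y)
    rw [Matrix.conjTranspose_add, hX, hY, neg_add]
  zero_mem' := by simp
  smul_mem' c X hX := by
    change Xᴴ = -X at hX
    change (c • X)ᴴ = -(c • X)
    rw [conjTranspose_real_smul, hX, smul_neg]
  lie_mem' {X Y} hX hY := by
    change Xᴴ = -X at hX
    change Yᴴ = -Y at hY
    change ⁅X, Y⁆ᴴ = -⁅X, Y⁆
    rw [Ring.lie_def, Matrix.conjTranspose_sub, Matrix.conjTranspose_mul,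
      Matrix.conjTranspose_mul, hX, hY]
    noncomm_ring

theorem mem_sp2 {X : Matrix (Fin 2) (Fin 2) ℍ[ℝ]} : X ∈ sp2 ↔ Xᴴ = -X := Iff.rfl

instance : FiniteDimensional ℝ sp2 :=
  inferInstanceAs (FiniteDimensional ℝ sp2.toSubmodule)

/-- The bi-invariant trace form `⟨X,Y⟩ = Re trace (X* Y)`. -/
def traceForm : LinearMap.BilinForm ℝ sp2 :=
  LinearMap.mk₂ ℝ (fun X Y : sp2 => (Matrix.trace (X.1ᴴ * Y.1)).re)
    (by intro X Y Z; simp [Matrix.add_mul, Matrix.conjTranspose_add])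
    (by intro c X Y; simp [conjTranspose_real_smul])
    (by intro X Y Z; simp [Matrix.mul_add])
    (by intro c X Y; simp)

theorem star_diag_sp2 (X : sp2) (i : Fin 2) : star (X.1 i i) = -X.1 i i :=
  congrFun (congrFun (mem_sp2.1 X.2) i) i

/-- The orthogonal projection of `𝔰𝔭(2)` onto `𝔨 = 𝔰𝔭(1) ⊕ 𝔰𝔭(1)`, the diagonal matrices;
its kernel `𝔭` consists of the matrices with zero diagonal. -/
def projK : sp2 →ₗ[ℝ] sp2 where
  toFun X := ⟨!![X.1 0 0, 0; 0, X.1 1 1], by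
    rw [mem_sp2]
    ext i j : 1
    fin_cases i <;> fin_cases j <;> simp [Matrix.conjTranspose_apply, star_diag_sp2]⟩
  map_add' X Y := by
    ext i j : 2
    fin_cases i <;> fin_cases j <;> simp
  map_smul' c X := by
    ext i j : 2
    fin_cases i <;> fin_cases j <;> simp

/-- The orthogonal projection of `𝔰𝔭(2)` onto `𝔥 = {diag(v, v)}`, the Lie algebra of the diagonal
`Δ Sp(1)`; the orthogonal complement `𝔮` of `𝔥` in `𝔨` is `{diag(v, -v)}`. -/
def projH : sp2 →ₗ[ℝ] sp2 where
  toFun X := ⟨!![(1 / 2 : ℝ) • (X.1 0 0 + X.1 1 1), 0; 0, (1 / 2 : ℝ) • (X.1 0 0 + X.1 1 1)], by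
    rw [mem_sp2]
    ext i j : 1
    fin_cases i <;> fin_cases j <;>
      simp [Matrix.conjTranspose_apply, star_diag_sp2, ← smul_neg] <;> abel_nf⟩
  map_add' X Y := by
    ext i j : 2
    fin_cases i <;> fin_cases j <;> simp [smul_add] <;> abel
  map_smul' c X := by
    ext i j : 2
    fin_cases i <;> fin_cases j <;> simp [smul_add, smul_comm c]

/-- The metric `⟨ , ⟩₁`: Cheeger contraction of the trace metric along `Sp(1) × Sp(1)`. -/
def metricOne (s : ℝ) : LinearMap.BilinForm ℝ sp2 := cheegerContraction traceForm projK s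

/-- The metric `⟨ , ⟩₂`: Cheeger contraction of `⟨ , ⟩₁` along `Δ Sp(1)`. -/
def metricTwo (s t : ℝ) : LinearMap.BilinForm ℝ sp2 :=
  cheegerContraction (metricOne s) projH t

theorem traceForm_isSymm : traceForm.IsSymm := by
  refine ⟨fun X Y => ?_⟩
  simp [traceForm, Matrix.trace, Matrix.mul_apply, Fin.sum_univ_two]
  ring

theorem traceForm_pos (X : sp2) (hX : X ≠ 0) : 0 < traceForm X X := by
  have e : traceForm X X = ∑ i, ∑ j, Quaternion.normSq (X.1 j i) := by
    simp [traceForm, Matrix.trace, Matrix.mul_apply, Fin.sum_univ_two, Quaternion.normSq_def']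
    ring
  rw [e]
  by_contra h
  apply hX
  have h0 (i : Fin 2) : 0 ≤ ∑ j, Quaternion.normSq (X.1 j i) :=
    Finset.sum_nonneg fun j _ => Quaternion.normSq_nonneg
  have h1 := (Finset.sum_eq_zero_iff_of_nonneg fun i _ => h0 i).1
    (le_antisymm (not_lt.1 h) (Finset.sum_nonneg fun i _ => h0 i))
  ext1
  ext j i : 1
  have h2 := (Finset.sum_eq_zero_iff_of_nonneg
    fun j _ => Quaternion.normSq_nonneg).1 (h1 i (Finset.mem_univ i)) j (Finset.mem_univ j)
  exact Quaternion.normSq_eq_zero.1 h2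

theorem metricTwo_isSymm (s t : ℝ) : (metricTwo s t).IsSymm :=
  cheegerContraction_isSymm (cheegerContraction_isSymm traceForm_isSymm _ _) _ _

theorem metricTwo_pos {s t : ℝ} (hs : 0 < s) (ht : 0 < t) (X : sp2) (hX : X ≠ 0) :
    0 < metricTwo s t X X :=
  cheegerContraction_pos (cheegerContraction_pos traceForm_pos _ hs) _ ht X hX

theorem metricTwo_nondegenerate {s t : ℝ} (hs : 0 < s) (ht : 0 < t) :
    (metricTwo s t).Nondegenerate := by
  constructor
  · intro X h
    by_contra hX
    exact (metricTwo_pos hs ht X hX).ne' (h X)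
  · intro X h
    by_contra hX
    exact (metricTwo_pos hs ht X hX).ne' (h X)

/-! ### The three types of planes -/

/-- The pair `X̃ = diag(0, y)`, `Ỹ = diag(y, 0)` with `y` a nonzero imaginary quaternion. -/
def IsTypeOne (X Y : Matrix (Fin 2) (Fin 2) ℍ[ℝ]) : Prop :=
  ∃ y : ℍ[ℝ], y.re = 0 ∧ y ≠ 0 ∧ X = !![0, 0; 0, y] ∧ Y = !![y, 0; 0, 0]

/-- The pair `X̃ = (0, -x̄; x, 0)`, `Ỹ = diag(y, x y x⁻¹)` with `x`, `y` nonzero, `y` imaginary. -/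
def IsTypeTwo (X Y : Matrix (Fin 2) (Fin 2) ℍ[ℝ]) : Prop :=
  ∃ x y : ℍ[ℝ], x ≠ 0 ∧ y.re = 0 ∧ y ≠ 0 ∧
    X = !![0, -star x; x, 0] ∧ Y = !![y, 0; 0, x * y * x⁻¹]

/-- The pairs `X̃ = X_± = (y, -x̄; x, ∓y)`, `Ỹ = Y_± = diag(y, ±y)` with `x`, `y` nonzero, `y`
imaginary and `x y x⁻¹ = ±y`. -/
def IsTypeThree (X Y : Matrix (Fin 2) (Fin 2) ℍ[ℝ]) : Prop :=
  ∃ x y : ℍ[ℝ], x ≠ 0 ∧ y.re = 0 ∧ y ≠ 0 ∧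
    ((x * y * x⁻¹ = y ∧ X = !![y, -star x; x, -y] ∧ Y = !![y, 0; 0, y]) ∨
      (x * y * x⁻¹ = -y ∧ X = !![y, -star x; x, y] ∧ Y = !![y, 0; 0, -y]))

end

/-!
The metric `⟨ , ⟩₂` arises from the bi-invariant trace form by two Cheeger contractions, and each
of them changes the curvature in a way that can be computed exactly.

Let `B` be an `ad 𝔥`-invariant metric, `P` the orthogonal projection onto the subalgebra `𝔥`, `B'`
the contraction of `B` along `𝔥`, and `μ = 1 - t / (t + 1)`. The Koszul formula gives
`∇'_X Y = ∇_X̃ Ỹ + μ [P X, Ỹ] + μ² / 2 [P X, P Y]`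
(`IsInvariantProjection.leviCivita_cheegerContraction`). Since `ad 𝔥` acts by derivations of `∇`,
and by the Jacobi identity, the unnormalised curvature of `B'` at `X, Y` is that of `B` at `X̃, Ỹ`
plus a nonnegative multiple of `|[P X, P Y]|²` plus a nonnegative multiple of
`|P [X̃, Ỹ] + μ t / (t + 1) [P X, P Y]|²`
(`IsInvariantProjection.curvatureForm_cheegerContraction`); the last term is the O'Neill term of the
submersion `G × H → G`.

The trace form has curvature `|[X, Y]|² / 4`. Contracting twice, the curvature of `⟨ , ⟩₂` is a sum
of nonnegative terms, and because `(𝔰𝔭(2), 𝔨)` is a symmetric pair it vanishes if and only if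
`X̃` and `Ỹ`, their `𝔨`-components and their `𝔥`-components all commute
(`curvatureForm_metricTwo_eq_zero_iff`). This condition depends only on the plane, so the basis may
be changed freely. Commuting `𝔭`-components are proportional, so one may take `Ỹ ∈ 𝔨`; since
commuting imaginary quaternions are proportional, what remains is a short computation with the
entries of the matrices, which ends in the three normal forms (`IsFlat.exists_normalPair`).
-/

/-! ### Curvature of a left-invariant metric -/

section LeftInvariantCurvature

variable {g : Type*} [LieRing g] [LieAlgebra ℝ g] [FiniteDimensional ℝ g]

omit [FiniteDimensional ℝ g] in
theorem eq_of_forall_bilin_eq {B : LinearMap.BilinForm ℝ g} (hB : B.Nondegenerate) {V W : g}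
    (h : ∀ Z, B V Z = B W Z) : V = W := by
  rw [← sub_eq_zero]
  exact hB.1 _ fun Z => by rw [map_sub, LinearMap.sub_apply, h, sub_self]

theorem leviCivita_eq_of_koszul {B : LinearMap.BilinForm ℝ g} (hB : B.Nondegenerate) {X Y V : g}
    (h : ∀ Z, 2 * B V Z = B ⁅X, Y⁆ Z - B ⁅Y, Z⁆ X + B ⁅Z, X⁆ Y) : leviCivita B hB X Y = V :=
  eq_of_forall_bilin_eq hB fun Z => by linarith [leviCivita_koszul B hB X Y Z, h Z]

theorem leviCivita_add_left (B : LinearMap.BilinForm ℝ g) (hB : B.Nondegenerate) (X X' Y : g) :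
    leviCivita B hB (X + X') Y = leviCivita B hB X Y + leviCivita B hB X' Y := by
  refine leviCivita_eq_of_koszul hB fun Z => ?_
  have h1 := leviCivita_koszul B hB X Y Z
  have h2 := leviCivita_koszul B hB X' Y Z
  simp only [add_lie, lie_add, map_add, LinearMap.add_apply]
  linarith

theorem leviCivita_smul_left (B : LinearMap.BilinForm ℝ g) (hB : B.Nondegenerate) (c : ℝ)
    (X Y : g) : leviCivita B hB (c • X) Y = c • leviCivita B hB X Y := by
  refine leviCivita_eq_of_koszul hB fun Z => ?_
  have h1 := leviCivita_koszul B hB X Y Z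
  simp only [smul_lie, lie_smul, map_smul, LinearMap.smul_apply, smul_eq_mul]
  linear_combination c * h1

/-- The unnormalised sectional curvature `B(R(X,Y)Y, X)`. -/
noncomputable def curvatureForm (B : LinearMap.BilinForm ℝ g) (hB : B.Nondegenerate)
    (X Y : g) : ℝ :=
  B (curvatureTensor B hB X Y Y) X

/-- Compatibility of the connection with the metric leaves only first derivatives of fields. -/
theorem curvatureForm_eq (B : LinearMap.BilinForm ℝ g) (hB : B.Nondegenerate) (hs : B.IsSymm)
    (X Y : g) :
    curvatureForm B hB X Y = -B (leviCivita B hB Y Y) (leviCivita B hB X X)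
      + B (leviCivita B hB X Y) (leviCivita B hB Y X)
      - B (leviCivita B hB ⁅X, Y⁆ Y) X := by
  have h1 := leviCivita_metric B hB hs X (leviCivita B hB Y Y) X
  have h2 := leviCivita_metric B hB hs Y (leviCivita B hB X Y) X
  simp only [curvatureForm, curvatureTensor, map_sub, LinearMap.sub_apply]
  linarith

/-- For a bi-invariant metric the curvature is `|[X,Y]|² / 4`. -/
theorem curvatureForm_of_biinvariant (B : LinearMap.BilinForm ℝ g) (hB : B.Nondegenerate)
    (hs : B.IsSymm) (hinv : ∀ X Y Z : g, B ⁅X, Y⁆ Z = -B Y ⁅X, Z⁆) (X Y : g) :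
    curvatureForm B hB X Y = 1 / 4 * B ⁅X, Y⁆ ⁅X, Y⁆ := by
  have hsym (U V : g) : B U V = B V U := by simpa using hs.eq U V
  have hD (U V : g) : leviCivita B hB U V = (1 / 2 : ℝ) • ⁅U, V⁆ := by
    refine leviCivita_eq_of_koszul hB fun Z => ?_
    have h1 := hinv V U Z
    have h2 := hinv V Z U
    have h3 := hinv U V Z
    have h4 := hinv U Z V
    rw [← lie_skew V U, map_neg] at h2
    rw [← lie_skew Z U, map_neg, LinearMap.neg_apply, map_smul, LinearMap.smul_apply, smul_eq_mul]
    linarith [hsym Z ⁅U, V⁆]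
  have h := hinv Y ⁅X, Y⁆ X
  rw [curvatureForm_eq B hB hs, hD, hD, hD, hD, hD]
  rw [← lie_skew ⁅X, Y⁆ Y, ← lie_skew Y X]
  rw [← lie_skew Y X] at h
  simp only [lie_self, smul_zero, map_zero, map_neg, smul_neg, LinearMap.neg_apply,
    map_smul, LinearMap.smul_apply, smul_eq_mul] at h ⊢
  linarith

end LeftInvariantCurvature

/-! ### Curvature of a Cheeger contraction -/

section CheegerStep

variable {g : Type*} [LieRing g] [LieAlgebra ℝ g] [FiniteDimensional ℝ g]

omit [FiniteDimensional ℝ g] in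
/-- The bracket of `X = X̃ + μ P X` and `Y = Ỹ + μ P Y`, where `μ = 1 - t / (t + 1)`. -/
theorem lie_eq_lie_tilde (P : g →ₗ[ℝ] g) (t : ℝ) (X Y : g) :
    ⁅X, Y⁆ = ⁅cheegerTilde P t X, cheegerTilde P t Y⁆
      + (1 - t / (t + 1)) • ⁅P X, cheegerTilde P t Y⁆
      - (1 - t / (t + 1)) • ⁅P Y, cheegerTilde P t X⁆
      + (1 - t / (t + 1)) ^ 2 • ⁅P X, P Y⁆ := by
  have hx (U : g) : U = cheegerTilde P t U + (1 - t / (t + 1)) • P U := by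
    simp only [cheegerTilde, sub_smul, one_smul]; abel
  conv_lhs => rw [hx X, hx Y]
  simp only [add_lie, lie_add, smul_lie, lie_smul, pow_two]
  rw [← lie_skew (cheegerTilde P t X) (P Y)]
  module

/-- The data of a Cheeger contraction: `P` is the `B`-orthogonal projection onto a subalgebra `𝔥`
of `g`, and `B` is `ad 𝔥`-invariant. -/
structure IsInvariantProjection (B : LinearMap.BilinForm ℝ g) (P : g →ₗ[ℝ] g) : Prop where
  idem : ∀ X, P (P X) = P X
  selfAdjoint : ∀ X Y, B (P X) Y = B X (P Y)
  lie_mem : ∀ X Y, P ⁅P X, P Y⁆ = ⁅P X, P Y⁆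
  skew : ∀ Z X Y, B ⁅P Z, X⁆ Y = -B X ⁅P Z, Y⁆

namespace IsInvariantProjection

variable {B : LinearMap.BilinForm ℝ g} {P : g →ₗ[ℝ] g}

omit [FiniteDimensional ℝ g] in
/-- `ad 𝔥` commutes with the projection, since it preserves `𝔥` and hence its complement. -/
theorem map_lie (h : IsInvariantProjection B P) (hB : B.Nondegenerate) (Z X : g) :
    P ⁅P Z, X⁆ = ⁅P Z, P X⁆ := by
  refine eq_of_forall_bilin_eq hB fun W => ?_
  have e : B ⁅P Z, P X⁆ W = B ⁅P Z, P X⁆ (P W) := by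
    rw [← h.selfAdjoint, h.lie_mem]
  rw [e, h.selfAdjoint, h.skew, h.skew, h.selfAdjoint, h.lie_mem]

/-- `ad 𝔥` acts by derivations of the Levi-Civita connection. -/
theorem lie_leviCivita (h : IsInvariantProjection B P) (hB : B.Nondegenerate) (Z X Y : g) :
    ⁅P Z, leviCivita B hB X Y⁆
      = leviCivita B hB ⁅P Z, X⁆ Y + leviCivita B hB X ⁅P Z, Y⁆ := by
  refine eq_of_forall_bilin_eq hB fun W => ?_
  have h1 := leviCivita_koszul B hB X Y ⁅P Z, W⁆
  have h2 := leviCivita_koszul B hB ⁅P Z, X⁆ Y W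
  have h3 := leviCivita_koszul B hB X ⁅P Z, Y⁆ W
  have e1 := h.skew Z ⁅X, Y⁆ W
  have e2 := h.skew Z ⁅Y, W⁆ X
  have e3 := h.skew Z ⁅W, X⁆ Y
  rw [leibniz_lie] at e1 e2 e3
  simp only [map_add, LinearMap.add_apply, h.skew Z (leviCivita B hB X Y)] at e1 e2 e3 ⊢
  linarith

/-- The `𝔥`-component of `∇_X Y` is half that of `[X,Y]`. -/
theorem proj_leviCivita (h : IsInvariantProjection B P) (hB : B.Nondegenerate) (hs : B.IsSymm)
    (X Y : g) : P (leviCivita B hB X Y) = (1 / 2 : ℝ) • P ⁅X, Y⁆ := by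
  refine eq_of_forall_bilin_eq hB fun Z => ?_
  have hsym (U V : g) : B U V = B V U := by simpa using hs.eq U V
  have h1 := leviCivita_koszul B hB X Y (P Z)
  rw [← lie_skew Y (P Z), map_neg, LinearMap.neg_apply] at h1
  have h2 := h.skew Z X Y
  have h3 := hsym X ⁅P Z, Y⁆
  rw [h.selfAdjoint, map_smul, LinearMap.smul_apply, smul_eq_mul, h.selfAdjoint]
  linarith

/-- Derivatives in the direction of `𝔥`. -/
theorem leviCivita_proj_left (h : IsInvariantProjection B P) (hB : B.Nondegenerate)
    (hs : B.IsSymm) (X Y Z : g) :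
    B (leviCivita B hB (P Z) Y) X = B ⁅P Z, Y⁆ X + 1 / 2 * B ⁅X, Y⁆ (P Z) := by
  have hsym (U V : g) : B U V = B V U := by simpa using hs.eq U V
  have h1 := leviCivita_koszul B hB (P Z) Y X
  have h2 := h.skew Z Y X
  rw [← lie_skew X (P Z), ← lie_skew Y X, map_neg, map_neg, LinearMap.neg_apply,
    LinearMap.neg_apply] at h1
  linarith [hsym Y ⁅P Z, X⁆]

omit [FiniteDimensional ℝ g] in
theorem cheegerContraction_apply (h : IsInvariantProjection B P) (t : ℝ) (X Y : g) :
    cheegerContraction B P t X Y = B X (cheegerTilde P t Y) := by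
  have e : cheegerContraction B P t X Y
      = B (X - P X) (Y - P Y) + t / (t + 1) * B (P X) (P Y) := rfl
  rw [e]
  have h1 := h.selfAdjoint X Y
  have h2 := h.selfAdjoint X (P Y)
  rw [h.idem] at h2
  simp only [cheegerTilde, map_sub, map_add, map_smul, LinearMap.sub_apply, smul_eq_mul]
  rw [h1, h2]
  ring

omit [FiniteDimensional ℝ g] in
theorem proj_tilde (h : IsInvariantProjection B P) (t : ℝ) (X : g) :
    P (cheegerTilde P t X) = (t / (t + 1)) • P X := by
  simp [cheegerTilde, h.idem]

omit [FiniteDimensional ℝ g] in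
theorem tilde_lie (h : IsInvariantProjection B P) (hB : B.Nondegenerate) (t : ℝ) (Z X : g) :
    cheegerTilde P t ⁅P Z, X⁆ = ⁅P Z, cheegerTilde P t X⁆ := by
  simp only [cheegerTilde, h.map_lie hB, lie_add, lie_sub, lie_smul]

/-- The connection of the contracted metric: with `ξ = P X`, `η = P Y` and `μ = 1 / (t + 1)`,
`∇'_X Y = ∇_X̃ Ỹ + μ [ξ, Ỹ] + μ² / 2 [ξ, η]`. -/
theorem leviCivita_cheegerContraction (h : IsInvariantProjection B P) (hB : B.Nondegenerate)
    (hs : B.IsSymm) {t : ℝ} (hB' : (cheegerContraction B P t).Nondegenerate)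
    (X Y : g) :
    leviCivita (cheegerContraction B P t) hB' X Y
      = leviCivita B hB (cheegerTilde P t X) (cheegerTilde P t Y)
        + (1 - t / (t + 1)) • ⁅P X, cheegerTilde P t Y⁆
        + ((1 - t / (t + 1)) ^ 2 / 2) • ⁅P X, P Y⁆ := by
  refine leviCivita_eq_of_koszul hB' fun Z => ?_
  have hsym (U V : g) : B U V = B V U := by simpa using hs.eq U V
  simp only [h.cheegerContraction_apply]
  rw [lie_eq_lie_tilde P t X Y, lie_eq_lie_tilde P t Y Z, lie_eq_lie_tilde P t Z X]
  have pX := h.proj_tilde t X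
  have pY := h.proj_tilde t Y
  have pZ := h.proj_tilde t Z
  have k0 := leviCivita_koszul B hB (cheegerTilde P t X) (cheegerTilde P t Y) (cheegerTilde P t Z)
  generalize cheegerTilde P t X = x at *
  generalize cheegerTilde P t Y = y at *
  generalize cheegerTilde P t Z = z at *
  generalize t / (t + 1) = c at *
  have c1 : B ⁅P X, P Y⁆ z = c * B ⁅P X, P Y⁆ (P Z) := by
    rw [← h.lie_mem, h.selfAdjoint, pZ, map_smul, smul_eq_mul, h.lie_mem]
  have c2 : B ⁅P Y, P Z⁆ x = c * B ⁅P X, P Y⁆ (P Z) := by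
    rw [← h.lie_mem Y Z, h.selfAdjoint, pX, map_smul, smul_eq_mul, h.skew,
      ← lie_skew (P Y) (P X), map_neg, hsym, neg_neg]
  have c3 : B ⁅P Z, P X⁆ y = c * B ⁅P X, P Y⁆ (P Z) := by
    rw [← h.lie_mem Z X, h.selfAdjoint, pY, map_smul, smul_eq_mul,
      ← lie_skew (P Z) (P X), map_neg, LinearMap.neg_apply, h.skew, hsym, neg_neg]
  have d1 := h.skew X y z
  have d2 := h.skew Y x z
  have d3 := h.skew Z y x
  rw [hsym y] at d1
  rw [hsym x] at d2
  rw [hsym y] at d3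
  simp only [map_add, map_sub, map_smul, LinearMap.add_apply, LinearMap.sub_apply,
    LinearMap.smul_apply, smul_eq_mul]
  rw [c1, c2, c3]
  linear_combination k0 + (1 - c) * (d1 + d2 - d3)

/-- The curvature of the contracted metric. The last two terms are the contribution of the second
factor of `G × H` and the O'Neill term of the submersion `G × H → G`. The cross terms that
involve derivatives cancel, because `ad 𝔥` acts by derivations of `∇`. -/
theorem curvatureForm_cheegerContraction (h : IsInvariantProjection B P) (hB : B.Nondegenerate)
    (hs : B.IsSymm) {t : ℝ} (hB' : (cheegerContraction B P t).Nondegenerate) (X Y : g) :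
    curvatureForm (cheegerContraction B P t) hB' X Y
      = curvatureForm B hB (cheegerTilde P t X) (cheegerTilde P t Y)
        + 1 / 4 * (t / (t + 1)) * (1 - t / (t + 1)) ^ 3 * B ⁅P X, P Y⁆ ⁅P X, P Y⁆
        + 3 / 4 * (1 - t / (t + 1)) *
          B (P ⁅cheegerTilde P t X, cheegerTilde P t Y⁆
              + (t / (t + 1) * (1 - t / (t + 1))) • ⁅P X, P Y⁆)
            (P ⁅cheegerTilde P t X, cheegerTilde P t Y⁆
              + (t / (t + 1) * (1 - t / (t + 1))) • ⁅P X, P Y⁆) := by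
  have hsym (U V : g) : B U V = B V U := by simpa using hs.eq U V
  rw [curvatureForm_eq _ hB' (cheegerContraction_isSymm hs P t), curvatureForm_eq B hB hs]
  have pF := congrArg P (lie_eq_lie_tilde P t X Y)
  have tF : cheegerTilde P t ⁅X, Y⁆ = ⁅X, Y⁆ - (1 - t / (t + 1)) • P ⁅X, Y⁆ := by
    simp only [cheegerTilde, sub_smul, one_smul]; abel
  simp only [h.leviCivita_cheegerContraction hB hs hB']
  rw [tF]
  have hF := lie_eq_lie_tilde P t X Y
  have pX := h.proj_tilde t X
  have pY := h.proj_tilde t Y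
  have hC (U V : g) : cheegerContraction B P t U V
      = B U V - (1 - t / (t + 1)) * B (P U) (P V) := by
    rw [h.cheegerContraction_apply, h.selfAdjoint, h.idem]
    simp only [cheegerTilde, map_add, map_sub, map_smul, smul_eq_mul]
    ring
  have hC' (U V : g) : cheegerContraction B P t U V = B U (cheegerTilde P t V) :=
    h.cheegerContraction_apply t U V
  rw [hC' _ X, hC, hC]
  generalize cheegerTilde P t X = x at *
  generalize cheegerTilde P t Y = y at *
  generalize t / (t + 1) = c at *
  obtain ⟨S, hS⟩ : ∃ S, S = ⁅P X, P Y⁆ := ⟨_, rfl⟩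
  obtain ⟨E, hE⟩ : ∃ E, E = P ⁅x, y⁆ := ⟨_, rfl⟩
  have hS' : ⁅P Y, P X⁆ = -S := by rw [hS, lie_skew]
  have hPS : P S = S := by rw [hS, h.lie_mem]
  have hxy : ⁅y, x⁆ = -⁅x, y⁆ := (lie_skew y x).symm
  -- the `𝔥`-components of the building blocks
  have q1 : P ⁅P X, y⁆ = c • S := by rw [h.map_lie hB, pY, lie_smul, hS]
  have q2 : P ⁅P Y, x⁆ = -(c • S) := by rw [h.map_lie hB, pX, lie_smul, hS', smul_neg]
  have q3 : P ⁅P X, x⁆ = 0 := by rw [h.map_lie hB, pX, lie_smul, lie_self, smul_zero]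
  have q4 : P ⁅P Y, y⁆ = 0 := by rw [h.map_lie hB, pY, lie_smul, lie_self, smul_zero]
  have hG : P ⁅X, Y⁆ = E + (2 * (1 - c) * c + (1 - c) ^ 2) • S := by
    rw [pF]
    simp only [map_add, map_sub, map_smul, q1, q2, ← hS, ← hE, hPS]
    module
  have pxy : P (leviCivita B hB x y) = (1 / 2 : ℝ) • E := by
    rw [h.proj_leviCivita hB hs, hE]
  have pyx : P (leviCivita B hB y x) = -((1 / 2 : ℝ) • E) := by
    rw [h.proj_leviCivita hB hs, hE, hxy, map_neg, smul_neg]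
  have pxx : P (leviCivita B hB x x) = 0 := by
    rw [h.proj_leviCivita hB hs, lie_self, map_zero, smul_zero]
  have pyy : P (leviCivita B hB y y) = 0 := by
    rw [h.proj_leviCivita hB hs, lie_self, map_zero, smul_zero]
  -- `∇_[X,Y] Ỹ`, expanded along the summands of `[X, Y]`
  have r1 : B (leviCivita B hB (P ⁅X, Y⁆) y) x
      = B ⁅P ⁅X, Y⁆, y⁆ x + 1 / 2 * B ⁅x, y⁆ (P ⁅X, Y⁆) := h.leviCivita_proj_left hB hs x y _
  have r2 : B (leviCivita B hB S y) x = B ⁅S, y⁆ x + 1 / 2 * B ⁅x, y⁆ S := by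
    have := h.leviCivita_proj_left hB hs x y S
    rwa [hPS] at this
  have r3 : B (leviCivita B hB ⁅P X, y⁆ y) x
      = -B (leviCivita B hB y y) ⁅P X, x⁆ + B ⁅P X, y⁆ (leviCivita B hB y x) := by
    have h1 := h.lie_leviCivita hB X y y
    have h2 := leviCivita_metric B hB hs y ⁅P X, y⁆ x
    rw [← h.skew, h1, map_add, LinearMap.add_apply]
    linarith
  have r4 : B (leviCivita B hB ⁅P Y, x⁆ y) x
      = -B (leviCivita B hB x y) ⁅P Y, x⁆ + B ⁅P Y, y⁆ (leviCivita B hB x x) := by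
    have h1 := h.lie_leviCivita hB Y x y
    have h2 := leviCivita_metric B hB hs x ⁅P Y, y⁆ x
    rw [← h.skew, h1, map_add, LinearMap.add_apply]
    linarith
  have r5 : B ⁅P ⁅X, Y⁆, P Y⁆ x = -(c * B (P ⁅X, Y⁆) S) := by
    rw [← h.lie_mem, h.selfAdjoint, pX, map_smul, smul_eq_mul, ← lie_skew _ (P Y), map_neg,
      LinearMap.neg_apply, h.skew, hS']
    simp only [map_neg]
    ring
  -- by the Jacobi identity the remaining products of brackets with `x` and `y` cancel
  have j1 : B ⁅S, y⁆ x = -B ⁅P Y, y⁆ ⁅P X, x⁆ + B ⁅P X, y⁆ ⁅P Y, x⁆ := by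
    rw [hS, lie_lie, map_sub, LinearMap.sub_apply, h.skew X ⁅P Y, y⁆,
      h.skew Y ⁅P X, y⁆]
    ring
  have s1 (V : g) : B V S = B (P V) S := by rw [h.selfAdjoint, hPS]
  have s2 (V : g) : B S V = B S (P V) := by rw [← h.selfAdjoint, hPS]
  have s3 : B ⁅x, y⁆ S = B E S := by rw [s1, hE]
  have s5 := s1 ⁅P X, y⁆
  have s6 := s2 ⁅P Y, x⁆
  have s7 := s1 (leviCivita B hB x y)
  have s8 := s2 (leviCivita B hB y x)
  rw [q1] at s5
  rw [q2] at s6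
  rw [pxy] at s7
  rw [pyx] at s8
  have sES := hsym S E
  have s9 : B ⁅x, y⁆ (P ⁅X, Y⁆) = B E (P ⁅X, Y⁆) := by rw [hE, h.selfAdjoint, h.idem]
  rw [s9] at r1
  have hL (U V W : g) (b : ℝ) : leviCivita B hB (U - b • V) W
      = leviCivita B hB U W - b • leviCivita B hB V W := by
    rw [sub_eq_add_neg, ← neg_smul, leviCivita_add_left, leviCivita_smul_left, neg_smul,
      ← sub_eq_add_neg]
  rw [hL]
  generalize P ⁅X, Y⁆ = G at *
  rw [hF]
  simp only [leviCivita_add_left, leviCivita_smul_left, hL, ← hS, ← hE, hS', lie_self, map_add,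
    map_sub, map_smul, map_neg, smul_neg, LinearMap.add_apply, LinearMap.sub_apply,
    LinearMap.smul_apply, smul_eq_mul, pxy, pyx, pxx, pyy, q1, q2, q3, q4, hPS, r1, r2, r3, r4, r5,
    j1, smul_zero, map_zero, LinearMap.zero_apply] at s5 s6 s7 s8 ⊢
  rw [s3, s5, s6, s7, s8, hG]
  simp only [map_add, map_smul, LinearMap.add_apply, LinearMap.smul_apply, smul_eq_mul, sES]
  ring

end IsInvariantProjection
end CheegerStep

/-! ### Bases of a plane -/

theorem span_pair_linear_comb {g : Type*} [AddCommGroup g] [Module ℝ g] (x y : g) {a b c d : ℝ}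
    (h : a * d - b * c ≠ 0) :
    Submodule.span ℝ {a • x + b • y, c • x + d • y} = Submodule.span ℝ {x, y} := by
  apply le_antisymm <;> rw [Submodule.span_le, Set.pair_subset_iff]
  · exact ⟨Submodule.mem_span_pair.2 ⟨a, b, rfl⟩, Submodule.mem_span_pair.2 ⟨c, d, rfl⟩⟩
  · refine ⟨Submodule.mem_span_pair.2 ⟨(a * d - b * c)⁻¹ * d, -((a * d - b * c)⁻¹ * b), ?_⟩,
      Submodule.mem_span_pair.2 ⟨-((a * d - b * c)⁻¹ * c), (a * d - b * c)⁻¹ * a, ?_⟩⟩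
    · have e : x = ((a * d - b * c)⁻¹ * (a * d - b * c)) • x := by rw [inv_mul_cancel₀ h, one_smul]
      conv_rhs => rw [e]
      module
    · have e : y = ((a * d - b * c)⁻¹ * (a * d - b * c)) • y := by rw [inv_mul_cancel₀ h, one_smul]
      conv_rhs => rw [e]
      module

section Planes

variable {g : Type*} [LieRing g] [LieAlgebra ℝ g] [FiniteDimensional ℝ g]

omit [FiniteDimensional ℝ g] in
/-- The strict Cauchy–Schwarz inequality, applied to the component of `Y` orthogonal to `X`. -/
theorem LinearIndependent.gram_det_pos {B : LinearMap.BilinForm ℝ g} (hs : B.IsSymm)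
    (hpos : ∀ X, X ≠ 0 → 0 < B X X) {X Y : g} (hli : LinearIndependent ℝ ![X, Y]) :
    0 < B X X * B Y Y - B X Y ^ 2 := by
  have hX : 0 < B X X := hpos X (hli.ne_zero 0)
  have hsym : B Y X = B X Y := by simpa using hs.eq Y X
  have hV : B X X • Y - B X Y • X ≠ 0 := by
    intro h
    have := (LinearIndependent.pair_iff.1 hli (-B X Y) (B X X) (by rw [← h]; module)).2
    exact hX.ne' this
  have h := hpos _ hV
  have e : B (B X X • Y - B X Y • X) (B X X • Y - B X Y • X)
      = B X X * (B X X * B Y Y - B X Y ^ 2) := by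
    simp only [map_sub, map_smul, LinearMap.sub_apply, LinearMap.smul_apply, smul_eq_mul, hsym]
    ring
  rw [e] at h
  exact pos_of_mul_pos_right h hX.le

theorem sectionalCurvature_eq_zero_iff {B : LinearMap.BilinForm ℝ g} (hB : B.Nondegenerate)
    (hs : B.IsSymm) (hpos : ∀ X, X ≠ 0 → 0 < B X X) {X Y : g}
    (hli : LinearIndependent ℝ ![X, Y]) :
    sectionalCurvature B hB X Y = 0 ↔ curvatureForm B hB X Y = 0 := by
  rw [sectionalCurvature, div_eq_zero_iff, or_iff_left (hli.gram_det_pos hs hpos).ne']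
  rfl

omit [FiniteDimensional ℝ g] in
theorem lie_map_eq_zero_of_mem_span (f : g →ₗ[ℝ] g) {x y x' y' : g} (h : ⁅f x, f y⁆ = 0)
    (hx : x' ∈ Submodule.span ℝ {x, y}) (hy : y' ∈ Submodule.span ℝ {x, y}) :
    ⁅f x', f y'⁆ = 0 := by
  obtain ⟨a, b, rfl⟩ := Submodule.mem_span_pair.1 hx
  obtain ⟨c, d, rfl⟩ := Submodule.mem_span_pair.1 hy
  have h' : ⁅f y, f x⁆ = 0 := by rw [← lie_skew, h, neg_zero]
  simp [h, h']

end Planes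

/-! ### The symmetric pair `(𝔰𝔭(2), 𝔨)` and its contracted metrics -/

theorem sp2_lie_coe (X Y : sp2) : (⁅X, Y⁆ : sp2).1 = X.1 * Y.1 - Y.1 * X.1 := rfl

theorem sp2_apply_zero_one (X : sp2) : X.1 0 1 = -star (X.1 1 0) := by
  have h := congrFun (congrFun (mem_sp2.1 X.2) 1) 0
  rw [Matrix.conjTranspose_apply, Matrix.neg_apply] at h
  rw [← star_star (X.1 0 1), h, star_neg]

theorem sp2_eq (X : sp2) : X.1 = !![X.1 0 0, -star (X.1 1 0); X.1 1 0, X.1 1 1] := by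
  rw [← sp2_apply_zero_one]
  exact Matrix.eta_fin_two X.1

theorem sp2_apply_re (X : sp2) (i : Fin 2) : (X.1 i i).re = 0 := by
  have h := congrArg QuaternionAlgebra.re (star_diag_sp2 X i)
  simp at h
  linarith

theorem sp2_eq_zero {X : sp2} (h0 : X.1 0 0 = 0) (h1 : X.1 1 0 = 0) (h2 : X.1 1 1 = 0) :
    X = 0 := by
  ext1
  rw [sp2_eq X, h0, h1, h2]
  ext i j : 1
  fin_cases i <;> fin_cases j <;> simp

theorem traceForm_apply (X Y : sp2) : traceForm X Y = -(Matrix.trace (X.1 * Y.1)).re := by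
  change (Matrix.trace (X.1ᴴ * Y.1)).re = _
  rw [mem_sp2.1 X.2, Matrix.neg_mul, Matrix.trace_neg, Quaternion.re_neg]

theorem trace_mul_fin_two (X Y : Matrix (Fin 2) (Fin 2) ℍ[ℝ]) :
    Matrix.trace (X * Y) = X 0 0 * Y 0 0 + X 0 1 * Y 1 0 + (X 1 0 * Y 0 1 + X 1 1 * Y 1 1) := by
  simp only [Matrix.trace_fin_two, Matrix.mul_apply, Fin.sum_univ_two]

theorem re_trace_mul_comm (X Y : Matrix (Fin 2) (Fin 2) ℍ[ℝ]) :
    (Matrix.trace (X * Y)).re = (Matrix.trace (Y * X)).re := by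
  simp [trace_mul_fin_two]
  ring

/-- The trace form is bi-invariant. -/
theorem traceForm_lie (X Y Z : sp2) : traceForm ⁅X, Y⁆ Z = -traceForm Y ⁅X, Z⁆ := by
  rw [traceForm_apply, traceForm_apply, sp2_lie_coe, sp2_lie_coe, Matrix.sub_mul, Matrix.mul_sub,
    Matrix.trace_sub, Matrix.trace_sub, Quaternion.re_sub, Quaternion.re_sub,
    Matrix.mul_assoc X.1, re_trace_mul_comm X.1, Matrix.mul_assoc, Matrix.mul_assoc]
  ring

theorem isInvariantProjection_projK : IsInvariantProjection traceForm projK where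
  idem X := by
    ext i j : 2
    fin_cases i <;> fin_cases j <;> simp [projK]
  selfAdjoint X Y := by
    rw [traceForm_apply, traceForm_apply, trace_mul_fin_two, trace_mul_fin_two]
    simp [projK]
  lie_mem X Y := by
    ext i j : 2
    fin_cases i <;> fin_cases j <;>
      simp [projK, Ring.lie_def]
  skew Z X Y := traceForm_lie _ _ _

theorem projH_projK (X : sp2) : projH (projK X) = projH X := by
  ext i j : 2
  fin_cases i <;> fin_cases j <;> simp [projK, projH]

theorem projK_projH (X : sp2) : projK (projH X) = projH X := by
  ext i j : 2
  fin_cases i <;> fin_cases j <;> simp [projK, projH]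

theorem isInvariantProjection_projH : IsInvariantProjection traceForm projH where
  idem X := by
    ext i j : 2
    fin_cases i <;> fin_cases j <;> simp [projH, ← two_smul ℝ, smul_smul]
  selfAdjoint X Y := by
    rw [traceForm_apply, traceForm_apply, trace_mul_fin_two, trace_mul_fin_two]
    simp [projH]
    ring
  lie_mem X Y := by
    ext i j : 2
    fin_cases i <;> fin_cases j <;>
      simp [projH, Ring.lie_def, ← two_smul ℝ, smul_smul]
  skew Z X Y := traceForm_lie _ _ _

theorem sp2_traceForm_nondegenerate : traceForm.Nondegenerate := by
  constructor
  · intro X h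
    by_contra hX
    exact (traceForm_pos X hX).ne' (h X)
  · intro X h
    by_contra hX
    exact (traceForm_pos X hX).ne' (h X)

theorem metricOne_pos {s : ℝ} (hs : 0 < s) (X : sp2) (hX : X ≠ 0) : 0 < metricOne s X X :=
  cheegerContraction_pos traceForm_pos _ hs X hX

theorem metricOne_nondegenerate {s : ℝ} (hs : 0 < s) : (metricOne s).Nondegenerate := by
  constructor
  · intro X h
    by_contra hX
    exact (metricOne_pos hs X hX).ne' (h X)
  · intro X h
    by_contra hX
    exact (metricOne_pos hs X hX).ne' (h X)

theorem metricOne_apply (s : ℝ) (X Y : sp2) :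
    metricOne s X Y = traceForm X (cheegerTilde projK s Y) :=
  isInvariantProjection_projK.cheegerContraction_apply s X Y

/-- The once contracted metric is still `ad 𝔥`-invariant, because `𝔥 ⊆ 𝔨`. -/
theorem isInvariantProjection_metricOne (s : ℝ) : IsInvariantProjection (metricOne s) projH where
  idem := isInvariantProjection_projH.idem
  selfAdjoint X Y := by
    rw [metricOne_apply, metricOne_apply, isInvariantProjection_projH.selfAdjoint]
    congr 1
    simp only [cheegerTilde, map_add, map_sub, map_smul, projH_projK, projK_projH]
  lie_mem := isInvariantProjection_projH.lie_mem
  skew Z X Y := by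
    rw [metricOne_apply, metricOne_apply, traceForm_lie, ← projK_projH Z,
      ← isInvariantProjection_projK.tilde_lie sp2_traceForm_nondegenerate]

/-- `[𝔭, 𝔭] ⊆ 𝔨`: the pair `(𝔤, 𝔨)` is symmetric. -/
theorem projK_lie_sub (X Y : sp2) :
    projK ⁅X - projK X, Y - projK Y⁆ = ⁅X - projK X, Y - projK Y⁆ := by
  ext i j : 2
  fin_cases i <;> fin_cases j <;>
    simp [projK, Ring.lie_def, Matrix.mul_apply, Matrix.vecMul, dotProduct,
      Fin.sum_univ_two] <;> abel

theorem lie_tilde_projK (s : ℝ) (X Y : sp2) :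
    ⁅cheegerTilde projK s X, cheegerTilde projK s Y⁆
      = ⁅X - projK X, Y - projK Y⁆ + (s / (s + 1)) ^ 2 • ⁅projK X, projK Y⁆
        + (s / (s + 1)) • (⁅projK X, Y - projK Y⁆ - ⁅projK Y, X - projK X⁆) := by
  simp only [cheegerTilde]
  generalize X - projK X = x
  generalize Y - projK Y = y
  simp only [add_lie, lie_add, smul_lie, lie_smul, pow_two]
  rw [← lie_skew x (projK Y)]
  module

/-- If the `𝔨`-components commute, contraction along the symmetric subalgebra `𝔨` does not affect
whether two elements commute, since `[𝔭, 𝔭] + [𝔨, 𝔨] ⊆ 𝔨` and `[𝔨, 𝔭] ⊆ 𝔭` vanish separately. -/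
theorem lie_tilde_projK_eq_zero_iff {s : ℝ} (hs : 0 < s) {X Y : sp2}
    (h : ⁅projK X, projK Y⁆ = 0) :
    ⁅cheegerTilde projK s X, cheegerTilde projK s Y⁆ = 0 ↔ ⁅X, Y⁆ = 0 := by
  have hc : s / (s + 1) ≠ 0 := by positivity
  have e : ⁅X, Y⁆ = ⁅X - projK X, Y - projK Y⁆
      + (⁅projK X, Y - projK Y⁆ - ⁅projK Y, X - projK X⁆) := by
    rw [← lie_skew (projK Y)]
    simp only [sub_lie, lie_sub, h]
    abel
  have key (c : ℝ) (hc : c ≠ 0) : ⁅X - projK X, Y - projK Y⁆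
      + c • (⁅projK X, Y - projK Y⁆ - ⁅projK Y, X - projK X⁆) = 0 ↔
      ⁅X - projK X, Y - projK Y⁆ = 0 ∧ ⁅projK X, Y - projK Y⁆ - ⁅projK Y, X - projK X⁆ = 0 := by
    refine ⟨fun h0 => ?_, fun h0 => by rw [h0.1, h0.2, smul_zero, add_zero]⟩
    have h1 := congrArg projK h0
    have hK (Z W : sp2) : projK ⁅projK Z, W - projK W⁆ = 0 := by
      rw [isInvariantProjection_projK.map_lie sp2_traceForm_nondegenerate, map_sub,
        isInvariantProjection_projK.idem, sub_self, lie_zero]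
    rw [map_add, map_smul, map_sub, hK, hK, projK_lie_sub, sub_zero, smul_zero, add_zero,
      map_zero] at h1
    rw [h1, zero_add, smul_eq_zero, or_iff_right hc] at h0
    exact ⟨h1, h0⟩
  rw [lie_tilde_projK, h, smul_zero, add_zero, key _ hc, e]
  have := key 1 one_ne_zero
  rw [one_smul] at this
  exact this.symm

/-- `X`, `Y`, their `𝔨`-components and their `𝔥`-components commute. -/
def IsFlat (X Y : sp2) : Prop :=
  ⁅X, Y⁆ = 0 ∧ ⁅projK X, projK Y⁆ = 0 ∧ ⁅projH X, projH Y⁆ = 0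

/-- The two contractions write the curvature as a sum of nonnegative terms, which vanish together
exactly for flat pairs. -/
theorem curvatureForm_metricTwo_eq_zero_iff {s t : ℝ} (hs : 0 < s) (ht : 0 < t) (X Y : sp2) :
    curvatureForm (metricTwo s t) (metricTwo_nondegenerate hs ht) X Y = 0 ↔
      IsFlat (cheegerTilde projH t X) (cheegerTilde projH t Y) := by
  have hnn0 (Z : sp2) : 0 ≤ traceForm Z Z := by
    by_cases h : Z = 0
    · simp [h]
    · exact (traceForm_pos Z h).le
  have hnn1 (Z : sp2) : 0 ≤ metricOne s Z Z := by
    by_cases h : Z = 0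
    · simp [h]
    · exact (metricOne_pos hs Z h).le
  have hz0 {Z : sp2} (h : traceForm Z Z = 0) : Z = 0 := by
    by_contra hZ
    exact (traceForm_pos Z hZ).ne' h
  have hz1 {Z : sp2} (h : metricOne s Z Z = 0) : Z = 0 := by
    by_contra hZ
    exact (metricOne_pos hs Z hZ).ne' h
  have e2 := (isInvariantProjection_metricOne s).curvatureForm_cheegerContraction
    (metricOne_nondegenerate hs) (cheegerContraction_isSymm traceForm_isSymm _ _)
    (metricTwo_nondegenerate hs ht) X Y
  have e1 := isInvariantProjection_projK.curvatureForm_cheegerContraction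
    sp2_traceForm_nondegenerate traceForm_isSymm (metricOne_nondegenerate hs)
    (cheegerTilde projH t X) (cheegerTilde projH t Y)
  rw [curvatureForm_of_biinvariant _ _ traceForm_isSymm traceForm_lie] at e1
  change curvatureForm (metricTwo s t) _ X Y = _ at e2
  change curvatureForm (metricOne s) _ _ _ = _ at e1
  rw [e1] at e2
  have hH : ⁅projH (cheegerTilde projH t X), projH (cheegerTilde projH t Y)⁆
      = (t / (t + 1)) ^ 2 • ⁅projH X, projH Y⁆ := by
    rw [isInvariantProjection_projH.proj_tilde, isInvariantProjection_projH.proj_tilde, smul_lie,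
      lie_smul, smul_smul, pow_two]
  have ha : 0 < s / (s + 1) := by positivity
  have ha' : 0 < 1 - s / (s + 1) := by
    rw [sub_pos, div_lt_one (by positivity)]; linarith
  have hb : 0 < t / (t + 1) := by positivity
  have hb' : 0 < 1 - t / (t + 1) := by
    rw [sub_pos, div_lt_one (by positivity)]; linarith
  rw [IsFlat, hH, smul_eq_zero, or_iff_right (pow_ne_zero 2 hb.ne')]
  generalize cheegerTilde projH t X = x at *
  generalize cheegerTilde projH t Y = y at *
  constructor
  · intro h0
    rw [h0] at e2
    have n1 := hnn0 ⁅cheegerTilde projK s x, cheegerTilde projK s y⁆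
    have n2 := mul_nonneg (mul_pos ha (pow_pos ha' 3)).le (hnn0 ⁅projK x, projK y⁆)
    have n3 := mul_nonneg ha'.le (hnn0 (projK ⁅cheegerTilde projK s x, cheegerTilde projK s y⁆
      + (s / (s + 1) * (1 - s / (s + 1))) • ⁅projK x, projK y⁆))
    have n4 := mul_nonneg (mul_pos hb (pow_pos hb' 3)).le (hnn1 ⁅projH X, projH Y⁆)
    have n5 := mul_nonneg hb'.le (hnn1 (projH ⁅x, y⁆
      + (t / (t + 1) * (1 - t / (t + 1))) • ⁅projH X, projH Y⁆))
    have z1 : ⁅cheegerTilde projK s x, cheegerTilde projK s y⁆ = 0 := hz0 (by linarith)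
    have z2 : ⁅projK x, projK y⁆ = 0 :=
      hz0 ((mul_eq_zero_iff_left (mul_pos ha (pow_pos ha' 3)).ne').1 (by linarith))
    have z3 : ⁅projH X, projH Y⁆ = 0 :=
      hz1 ((mul_eq_zero_iff_left (mul_pos hb (pow_pos hb' 3)).ne').1 (by linarith))
    exact ⟨(lie_tilde_projK_eq_zero_iff hs z2).1 z1, z2, z3⟩
  · rintro ⟨h1, h2, h3⟩
    rw [e2, (lie_tilde_projK_eq_zero_iff hs h2).2 h1, h1, h2, h3]
    simp

/-! ### Commuting pairs in `𝔰𝔭(2)` -/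

theorem IsFlat.of_span_eq {x y x' y' : sp2} (h : IsFlat x y)
    (hs : Submodule.span ℝ {x', y'} = Submodule.span ℝ {x, y}) : IsFlat x' y' := by
  have hx : x' ∈ Submodule.span ℝ {x, y} := hs ▸ Submodule.subset_span (by simp)
  have hy : y' ∈ Submodule.span ℝ {x, y} := hs ▸ Submodule.subset_span (by simp)
  exact ⟨lie_map_eq_zero_of_mem_span LinearMap.id h.1 hx hy,
    lie_map_eq_zero_of_mem_span projK h.2.1 hx hy, lie_map_eq_zero_of_mem_span projH h.2.2 hx hy⟩

/-- If `x ȳ` is real then `x` is a real multiple of `y`. -/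
theorem Quaternion.exists_eq_smul_of_star_mul {x y : ℍ[ℝ]} (hy : y ≠ 0)
    (h : star (x * star y) = x * star y) : ∃ c : ℝ, x = c • y := by
  obtain ⟨r, hr⟩ : ∃ r : ℝ, x * star y = r := ⟨_, (Quaternion.star_eq_self.1 h)⟩
  have hn : Quaternion.normSq y ≠ 0 := Quaternion.normSq_ne_zero.2 hy
  refine ⟨r / Quaternion.normSq y, ?_⟩
  have e : Quaternion.normSq y • x = r • y := by
    have := congrArg (· * y) hr
    simp only [mul_assoc, Quaternion.star_mul_self] at this
    rwa [Quaternion.mul_coe_eq_smul, Quaternion.coe_mul_eq_smul] at this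
  rw [div_eq_inv_mul, mul_smul, ← e, smul_smul, inv_mul_cancel₀ hn, one_smul]

/-- Commuting imaginary quaternions are proportional. -/
theorem Quaternion.exists_eq_smul_of_commute {x y : ℍ[ℝ]} (hx : x.re = 0) (hy : y.re = 0)
    (hy0 : y ≠ 0) (h : x * y = y * x) : ∃ c : ℝ, x = c • y := by
  have sx : star x = -x := Quaternion.star_eq_neg.2 hx
  have sy : star y = -y := Quaternion.star_eq_neg.2 hy
  have hr : star (x * star y) = x * star y := by
    rw [star_mul, star_star, sx, sy, mul_neg, mul_neg, h]
  exact Quaternion.exists_eq_smul_of_star_mul hy0 hr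

theorem IsFlat.entries {x y : sp2} (h : IsFlat x y) :
    x.1 0 0 * y.1 0 0 = y.1 0 0 * x.1 0 0 ∧ x.1 1 1 * y.1 1 1 = y.1 1 1 * x.1 1 1 ∧
      (x.1 0 0 + x.1 1 1) * (y.1 0 0 + y.1 1 1) = (y.1 0 0 + y.1 1 1) * (x.1 0 0 + x.1 1 1) ∧
      x.1 1 0 * star (y.1 1 0) = y.1 1 0 * star (x.1 1 0) ∧
      x.1 1 0 * y.1 0 0 + x.1 1 1 * y.1 1 0 = y.1 1 0 * x.1 0 0 + y.1 1 1 * x.1 1 0 := by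
  obtain ⟨h1, h2, h3⟩ := h
  have E (Z W : sp2) (h : ⁅Z, W⁆ = 0) (i j : Fin 2) : (Z.1 * W.1) i j = (W.1 * Z.1) i j := by
    have h' : Z.1 * W.1 - W.1 * Z.1 = 0 := congrArg Subtype.val h
    rw [sub_eq_zero.1 h']
  have a0 := E _ _ h2 0 0
  have a1 := E _ _ h2 1 1
  have a2 := E _ _ h3 0 0
  have a3 := E _ _ h1 1 1
  have a4 := E _ _ h1 1 0
  simp only [Matrix.mul_apply, Fin.sum_univ_two] at a3 a4
  simp [projK, Matrix.mul_apply, Fin.sum_univ_two] at a0 a1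
  simp [projH, Matrix.mul_apply, Fin.sum_univ_two, -smul_add] at a2
  rw [sp2_apply_zero_one, sp2_apply_zero_one, a1] at a3
  refine ⟨a0, a1, a2, ?_, a4⟩
  simpa using a3

/-- Conversely the conditions on the entries suffice when the second matrix is diagonal. -/
theorem isFlat_of_diagonal {x y : sp2} (h0 : x.1 0 0 * y.1 0 0 = y.1 0 0 * x.1 0 0)
    (h1 : x.1 1 1 * y.1 1 1 = y.1 1 1 * x.1 1 1)
    (h2 : (x.1 0 0 + x.1 1 1) * (y.1 0 0 + y.1 1 1)
      = (y.1 0 0 + y.1 1 1) * (x.1 0 0 + x.1 1 1))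
    (h3 : y.1 1 0 = 0) (h4 : x.1 1 0 * y.1 0 0 = y.1 1 1 * x.1 1 0) : IsFlat x y := by
  have hy : y.1 0 1 = 0 := by rw [sp2_apply_zero_one, h3, star_zero, neg_zero]
  have h5 : x.1 0 1 * y.1 1 1 = y.1 0 0 * x.1 0 1 := by
    have := congrArg star h4
    rw [star_mul, star_mul, star_diag_sp2, star_diag_sp2] at this
    rw [sp2_apply_zero_one]
    simpa using this.symm
  refine ⟨?_, ?_, ?_⟩
  · ext i j : 2
    fin_cases i <;> fin_cases j <;>
      simp [Ring.lie_def, Matrix.mul_apply, Fin.sum_univ_two, h0, h1, h3, h4, h5, hy]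
  · ext i j : 2
    fin_cases i <;> fin_cases j <;>
      simp [Ring.lie_def, projK, h0, h1]
  · ext i j : 2
    fin_cases i <;> fin_cases j <;>
      simp [Ring.lie_def, projH, h2, -smul_add]

/-- The pair has one of the three normal forms. -/
def IsNormalPair (X Y : Matrix (Fin 2) (Fin 2) ℍ[ℝ]) : Prop :=
  IsTypeOne X Y ∨ IsTypeTwo X Y ∨ IsTypeThree X Y

theorem IsNormalPair.isFlat {x y : sp2} (h : IsNormalPair x.1 y.1) : IsFlat x y := by
  rcases h with ⟨p, -, -, hx, hy⟩ | ⟨w, p, hw, -, -, hx, hy⟩ |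
    ⟨w, p, hw, -, -, ⟨hp, hx, hy⟩ | ⟨hp, hx, hy⟩⟩
  · apply isFlat_of_diagonal <;> simp [hx, hy]
  · apply isFlat_of_diagonal <;> simp [hx, hy, mul_assoc, hw]
  · rw [mul_inv_eq_iff_eq_mul₀ hw] at hp
    apply isFlat_of_diagonal <;> simp [hx, hy, hp]
  · rw [mul_inv_eq_iff_eq_mul₀ hw] at hp
    apply isFlat_of_diagonal <;> simp [hx, hy, hp]

theorem IsNormalPair.linearIndependent {x y : sp2} (h : IsNormalPair x.1 y.1) :
    LinearIndependent ℝ ![x, y] := by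
  rw [LinearIndependent.pair_iff]
  intro a b hab
  have E (i j : Fin 2) : a • x.1 i j + b • y.1 i j = 0 :=
    congrFun (congrFun (congrArg Subtype.val hab) i) j
  have e0 := E 0 0
  have e1 := E 1 0
  have e2 := E 1 1
  rcases h with ⟨p, -, hp0, hx, hy⟩ | ⟨w, p, hw, -, hp0, hx, hy⟩ |
    ⟨w, p, hw, -, hp0, ⟨hp, hx, hy⟩ | ⟨hp, hx, hy⟩⟩
  all_goals simp_all

/-- The plane spanned by a flat pair of diagonal matrices consists of all `diag(a u, b u)` for a
fixed imaginary `u`. -/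
theorem IsFlat.exists_normalPair_of_diagonal {x y : sp2} (h : IsFlat x y)
    (hli : LinearIndependent ℝ ![x, y]) (hx : x.1 1 0 = 0) (hy : y.1 1 0 = 0)
    (hy0 : y.1 0 0 ≠ 0) :
    ∃ x' y' : sp2, Submodule.span ℝ {x', y'} = Submodule.span ℝ {x, y} ∧
      IsTypeOne x'.1 y'.1 := by
  have hpi := LinearIndependent.pair_iff.1 hli
  obtain ⟨h0, h1, h2, -, -⟩ := h.entries
  obtain ⟨a, ha⟩ := Quaternion.exists_eq_smul_of_commute (sp2_apply_re x 0) (sp2_apply_re y 0)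
    hy0 h0
  -- `u` is the lower right entry of `x - a y = diag(0, u)`
  obtain ⟨u, hu⟩ : ∃ u, u = x.1 1 1 - a • y.1 1 1 := ⟨_, rfl⟩
  have hure : u.re = 0 := by
    simp [hu, sp2_apply_re]
  have hu0 : u ≠ 0 := by
    intro hu0
    have hz : (1 : ℝ) • x + (-a) • y = 0 := by
      apply sp2_eq_zero
      · simp [ha]
      · simp [hx, hy]
      · simpa [hu0, sub_eq_add_neg] using hu.symm
    exact one_ne_zero (hpi _ _ hz).1
  have hc : y.1 1 1 * u = u * y.1 1 1 := by
    rw [hu, mul_sub, sub_mul, h1, mul_smul_comm, smul_mul_assoc]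
  obtain ⟨b, hb⟩ := Quaternion.exists_eq_smul_of_commute (sp2_apply_re y 1) hure hu0 hc
  have hp : y.1 0 0 * u = u * y.1 0 0 := by
    have hx1 : x.1 1 1 = u + a • y.1 1 1 := by rw [hu]; abel
    have hsum : x.1 0 0 + x.1 1 1 = u + a • (y.1 0 0 + y.1 1 1) := by
      rw [hx1, ha]; module
    rw [hsum, add_mul, mul_add (y.1 0 0 + y.1 1 1), smul_mul_assoc, mul_smul_comm,
      add_left_inj, mul_add, add_mul, hc, add_left_inj] at h2
    exact h2.symm
  obtain ⟨c, hc⟩ := Quaternion.exists_eq_smul_of_commute (sp2_apply_re y 0) hure hu0 hp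
  have hc0 : c ≠ 0 := by
    rintro rfl
    exact hy0 (by rw [hc, zero_smul])
  -- the pair `x - a y = diag(0, u)` and `c⁻¹ (y - b (x - a y)) = diag(u, 0)`
  refine ⟨(1 : ℝ) • x + (-a) • y, (-(c⁻¹ * b)) • x + (c⁻¹ * (1 + a * b)) • y,
    span_pair_linear_comb x y ?_, u, hure, hu0, ?_, ?_⟩
  · have : 1 * (c⁻¹ * (1 + a * b)) - -a * -(c⁻¹ * b) = c⁻¹ := by ring
    rw [this]
    exact inv_ne_zero hc0
  · rw [sp2_eq ((1 : ℝ) • x + (-a) • y)]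
    have e0 : ((1 : ℝ) • x + (-a) • y).1 0 0 = 0 := by simp [ha]
    have e1 : ((1 : ℝ) • x + (-a) • y).1 1 0 = 0 := by simp [hx, hy]
    have e2 : ((1 : ℝ) • x + (-a) • y).1 1 1 = u := by simp [hu, sub_eq_add_neg]
    rw [e0, e1, e2, star_zero, neg_zero]
  · rw [sp2_eq ((-(c⁻¹ * b)) • x + (c⁻¹ * (1 + a * b)) • y)]
    have hx1 : x.1 1 1 = u + a • y.1 1 1 := by rw [hu]; abel
    have e0 : ((-(c⁻¹ * b)) • x + (c⁻¹ * (1 + a * b)) • y).1 0 0 = u := by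
      change (-(c⁻¹ * b)) • x.1 0 0 + (c⁻¹ * (1 + a * b)) • y.1 0 0 = u
      rw [ha, hc]
      have : u = (c⁻¹ * c) • u := by rw [inv_mul_cancel₀ hc0, one_smul]
      conv_rhs => rw [this]
      module
    have e1 : ((-(c⁻¹ * b)) • x + (c⁻¹ * (1 + a * b)) • y).1 1 0 = 0 := by simp [hx, hy]
    have e2 : ((-(c⁻¹ * b)) • x + (c⁻¹ * (1 + a * b)) • y).1 1 1 = 0 := by
      change (-(c⁻¹ * b)) • x.1 1 1 + (c⁻¹ * (1 + a * b)) • y.1 1 1 = 0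
      rw [hx1, hb]
      module
    rw [e0, e1, e2, star_zero, neg_zero]

/-- A flat pair with `x ∉ 𝔨` and `y ∈ 𝔨`. Write `diag(p, q)` for `y` and `w` for the lower left
entry of `x`; then `q = w p w⁻¹`, and the diagonal of `x` is `(a p, b q)`. If `a = b`, subtracting
`a y` makes it vanish. Otherwise the commuting `𝔥`-components force `p` and `q` to commute, so that
`q = ± p`. -/
theorem IsFlat.exists_normalPair_of_ne_zero {x y : sp2} (h : IsFlat x y)
    (hli : LinearIndependent ℝ ![x, y]) (hx : x.1 1 0 ≠ 0) (hy : y.1 1 0 = 0) :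
    ∃ x' y' : sp2, Submodule.span ℝ {x', y'} = Submodule.span ℝ {x, y} ∧
      (IsTypeTwo x'.1 y'.1 ∨ IsTypeThree x'.1 y'.1) := by
  obtain ⟨h0, h1, h2, -, h4⟩ := h.entries
  rw [hy, mul_zero, zero_mul, add_zero, zero_add] at h4
  have hq : y.1 1 1 = x.1 1 0 * y.1 0 0 * (x.1 1 0)⁻¹ := by
    rw [h4, mul_assoc, mul_inv_cancel₀ hx, mul_one]
  have hp0 : y.1 0 0 ≠ 0 := by
    intro hp0
    rw [hp0, mul_zero, zero_mul] at hq
    exact hli.ne_zero 1 (sp2_eq_zero hp0 hy hq)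
  have hq0 : y.1 1 1 ≠ 0 := by
    rw [hq]
    exact mul_ne_zero (mul_ne_zero hx hp0) (inv_ne_zero hx)
  obtain ⟨a, ha⟩ := Quaternion.exists_eq_smul_of_commute (sp2_apply_re x 0) (sp2_apply_re y 0)
    hp0 h0
  obtain ⟨b, hb⟩ := Quaternion.exists_eq_smul_of_commute (sp2_apply_re x 1) (sp2_apply_re y 1)
    hq0 h1
  have hye : y.1 = !![y.1 0 0, 0; 0, y.1 1 1] := by
    conv_lhs => rw [sp2_eq y]
    rw [hy, star_zero, neg_zero]
  by_cases hab : a = b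
  · refine ⟨(1 : ℝ) • x + (-a) • y, (0 : ℝ) • x + (1 : ℝ) • y,
      span_pair_linear_comb x y (by simp), Or.inl ⟨x.1 1 0, y.1 0 0, hx, sp2_apply_re y 0, hp0,
        ?_, ?_⟩⟩
    · rw [sp2_eq ((1 : ℝ) • x + (-a) • y)]
      have e0 : ((1 : ℝ) • x + (-a) • y).1 0 0 = 0 := by simp [ha]
      have e1 : ((1 : ℝ) • x + (-a) • y).1 1 0 = x.1 1 0 := by simp [hy]
      have e2 : ((1 : ℝ) • x + (-a) • y).1 1 1 = 0 := by simp [hb, hab]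
      rw [e0, e1, e2]
    · rw [zero_smul, one_smul, zero_add, ← hq]
      exact hye
  -- the two diagonal entries of `y` commute, so that they agree up to sign
  have hpq : y.1 1 1 * y.1 0 0 = y.1 0 0 * y.1 1 1 := by
    have e : (b - a) • (y.1 1 1 * y.1 0 0) = (b - a) • (y.1 0 0 * y.1 1 1) := by
      rw [ha, hb] at h2
      simp only [add_mul, mul_add, smul_mul_assoc, mul_smul_comm] at h2
      rw [← sub_eq_zero] at h2 ⊢
      rw [← h2]
      module
    exact smul_right_injective _ (sub_ne_zero.2 (Ne.symm hab)) e
  obtain ⟨ε, hε⟩ := Quaternion.exists_eq_smul_of_commute (sp2_apply_re y 1) (sp2_apply_re y 0)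
    hp0 hpq
  have hε2 : ε = 1 ∨ ε = -1 := by
    have e := congrArg norm h4
    rw [norm_mul, norm_mul, mul_comm, hε, norm_smul] at e
    have e' := mul_right_cancel₀ (norm_ne_zero_iff.2 hx) e
    have e'' : ‖ε‖ = 1 := by
      have := norm_ne_zero_iff.2 hp0
      field_simp at e'
      linarith
    rwa [Real.norm_eq_abs, abs_eq zero_le_one] at e''
  obtain ⟨d, hd⟩ : ∃ d, d = (a - b) / 2 := ⟨_, rfl⟩
  have hd0 : d ≠ 0 := by
    rw [hd]
    exact div_ne_zero (sub_ne_zero.2 hab) two_ne_zero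
  have had : a = b + 2 * d := by rw [hd]; ring
  -- subtracting the mean of `a` and `b` makes the diagonal `d • (p, -q)`
  obtain ⟨z, hz⟩ : ∃ z : sp2, z = d⁻¹ • x + (-(d⁻¹ * (b + d))) • y := ⟨_, rfl⟩
  have e0 : z.1 0 0 = y.1 0 0 := by
    rw [hz]
    change d⁻¹ • x.1 0 0 + (-(d⁻¹ * (b + d))) • y.1 0 0 = y.1 0 0
    rw [ha, had]
    match_scalars
    field_simp
    ring
  have e1 : z.1 1 0 = d⁻¹ • x.1 1 0 := by simp [hz, hy]
  have e2 : z.1 1 1 = -y.1 1 1 := by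
    rw [hz]
    change d⁻¹ • x.1 1 1 + (-(d⁻¹ * (b + d))) • y.1 1 1 = -y.1 1 1
    rw [hb]
    match_scalars
    field_simp
    ring
  have hw0 : z.1 1 0 ≠ 0 := by
    rw [e1]
    exact smul_ne_zero (inv_ne_zero hd0) hx
  have hconj : z.1 1 0 * y.1 0 0 * (z.1 1 0)⁻¹ = y.1 1 1 := by
    rw [mul_inv_eq_iff_eq_mul₀ hw0, e1, smul_mul_assoc, mul_smul_comm, h4]
  refine ⟨z, (0 : ℝ) • x + (1 : ℝ) • y, ?_, Or.inr ⟨z.1 1 0, y.1 0 0, hw0, sp2_apply_re y 0, hp0,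
    ?_⟩⟩
  · rw [hz]
    exact span_pair_linear_comb x y (by simpa using hd0)
  · rw [zero_smul, one_smul, zero_add, hconj]
    rcases hε2 with rfl | rfl
    · rw [one_smul] at hε
      refine Or.inl ⟨hε, ?_, ?_⟩
      · conv_lhs => rw [sp2_eq z, e0, e2, hε]
      · conv_lhs => rw [hye, hε]
    · rw [neg_one_smul] at hε
      refine Or.inr ⟨hε, ?_, ?_⟩
      · conv_lhs => rw [sp2_eq z, e0, e2, hε, neg_neg]
      · conv_lhs => rw [hye, hε]

theorem linearIndependent_pair_of_span_eq {x y x' y' : sp2}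
    (hli : LinearIndependent ℝ ![x, y])
    (h : Submodule.span ℝ {x', y'} = Submodule.span ℝ {x, y}) :
    LinearIndependent ℝ ![x', y'] := by
  have h1 := linearIndependent_iff_card_eq_finrank_span.1 hli
  rw [linearIndependent_iff_card_eq_finrank_span, h1]
  rw [Set.finrank, Set.finrank, Matrix.range_cons_cons_empty, Matrix.range_cons_cons_empty, h]

/-- A flat pair can be replaced by a pair in normal form with the same span. -/
theorem IsFlat.exists_normalPair {x y : sp2} (h : IsFlat x y)
    (hli : LinearIndependent ℝ ![x, y]) :
    ∃ x' y' : sp2, Submodule.span ℝ {x', y'} = Submodule.span ℝ {x, y} ∧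
      IsNormalPair x'.1 y'.1 := by
  -- the `𝔭`-components commute, hence are proportional: pass to a basis with `y₁ ∈ 𝔨`
  obtain ⟨x₁, y₁, hs, hy₁⟩ : ∃ x₁ y₁ : sp2,
      Submodule.span ℝ {x₁, y₁} = Submodule.span ℝ {x, y} ∧ y₁.1 1 0 = 0 := by
    by_cases hx : x.1 1 0 = 0
    · exact ⟨y, x, by rw [Set.pair_comm], hx⟩
    · obtain ⟨c, hc⟩ : ∃ c : ℝ, y.1 1 0 = c • x.1 1 0 := by
        apply Quaternion.exists_eq_smul_of_star_mul hx
        rw [star_mul, star_star]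
        exact h.entries.2.2.2.1
      refine ⟨(1 : ℝ) • x + (0 : ℝ) • y, (-c) • x + (1 : ℝ) • y,
        span_pair_linear_comb x y (by simp), ?_⟩
      simp [hc]
  have h₁ := h.of_span_eq hs
  have hli₁ := linearIndependent_pair_of_span_eq hli hs
  rw [← hs]
  by_cases hx₁ : x₁.1 1 0 = 0
  · by_cases hy0 : y₁.1 0 0 = 0
    · by_cases hx0 : x₁.1 0 0 = 0
      · exfalso
        have hy1 : y₁.1 1 1 ≠ 0 := fun h' => hli₁.ne_zero 1 (sp2_eq_zero hy0 hy₁ h')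
        obtain ⟨c, hc⟩ := Quaternion.exists_eq_smul_of_commute (sp2_apply_re x₁ 1)
          (sp2_apply_re y₁ 1) hy1 h₁.entries.2.1
        have hz : (1 : ℝ) • x₁ + (-c) • y₁ = 0 := by
          apply sp2_eq_zero <;> simp [hx0, hy0, hx₁, hy₁, hc]
        exact one_ne_zero (LinearIndependent.pair_iff.1 hli₁ _ _ hz).1
      · have hs' : Submodule.span ℝ {y₁, x₁} = Submodule.span ℝ {x₁, y₁} := by
          rw [Set.pair_comm]
        obtain ⟨x', y', hs'', ht⟩ := (h₁.of_span_eq hs').exists_normalPair_of_diagonal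
          (linearIndependent_pair_of_span_eq hli₁ hs') hy₁ hx₁ hx0
        exact ⟨x', y', hs''.trans hs', Or.inl ht⟩
    · obtain ⟨x', y', hs', ht⟩ := h₁.exists_normalPair_of_diagonal hli₁ hx₁ hy₁ hy0
      exact ⟨x', y', hs', Or.inl ht⟩
  · obtain ⟨x', y', hs', ht⟩ := h₁.exists_normalPair_of_ne_zero hli₁ hx₁ hy₁
    exact ⟨x', y', hs', Or.inr ht⟩

/-! ### Planes of zero curvature -/

/-- The map `X ↦ X̃` is a linear isomorphism. -/
noncomputable def tildeEquiv {t : ℝ} (ht : 0 < t) : sp2 ≃ₗ[ℝ] sp2 :=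
  LinearEquiv.ofInjectiveEndo
    ((LinearMap.id - projH) + (t / (t + 1)) • projH) <| by
      rw [← LinearMap.ker_eq_bot, LinearMap.ker_eq_bot']
      intro X hX
      change cheegerTilde projH t X = 0 at hX
      have hc : t / (t + 1) ≠ 0 := by positivity
      have h1 := congrArg projH hX
      rw [isInvariantProjection_projH.proj_tilde, map_zero, smul_eq_zero, or_iff_right hc] at h1
      simpa [cheegerTilde, h1] using hX

theorem map_tildeEquiv_span_pair {t : ℝ} (ht : 0 < t) (X Y : sp2) :
    (Submodule.span ℝ {X, Y}).map (tildeEquiv ht).toLinearMap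
      = Submodule.span ℝ {cheegerTilde projH t X, cheegerTilde projH t Y} := by
  rw [Submodule.map_span, Set.image_pair]
  rfl

theorem mainTheorem2 (s t : ℝ) (hs : 0 < s) (ht : 0 < t) (σ : Submodule ℝ sp2) :
    IsZeroCurvaturePlane (metricTwo s t) (metricTwo_nondegenerate hs ht) σ ↔
      ∃ X Y : sp2, σ = Submodule.span ℝ {X, Y} ∧
        (IsTypeOne (cheegerTilde projH t X).1 (cheegerTilde projH t Y).1 ∨
          IsTypeTwo (cheegerTilde projH t X).1 (cheegerTilde projH t Y).1 ∨
          IsTypeThree (cheegerTilde projH t X).1 (cheegerTilde projH t Y).1) := by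
  have hmap : Function.Injective (Submodule.map (tildeEquiv ht).toLinearMap) :=
    Submodule.map_injective_of_injective (tildeEquiv ht).injective
  constructor
  · rintro ⟨hdim, hσ⟩
    obtain ⟨X, Y, hXY, hli⟩ : ∃ X Y : sp2, Submodule.span ℝ {X, Y} = σ ∧
        LinearIndependent ℝ ![X, Y] := by
      let b := Module.finBasisOfFinrankEq ℝ σ hdim
      have hb : ![(b 0 : sp2), (b 1 : sp2)] = σ.subtype ∘ b := by
        ext i : 1
        fin_cases i <;> rfl
      refine ⟨b 0, b 1, ?_, ?_⟩
      · have h1 : ({(b 0 : sp2), (b 1 : sp2)} : Set sp2) = σ.subtype '' Set.range b := by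
          rw [← Set.range_comp, ← hb, Matrix.range_cons_cons_empty]
        rw [h1, ← Submodule.map_span, b.span_eq, Submodule.map_top, Submodule.range_subtype]
      · rw [hb]
        exact b.linearIndependent.map' _ σ.ker_subtype
    have h0 := hσ X Y hXY
    rw [sectionalCurvature_eq_zero_iff _ (metricTwo_isSymm s t) (metricTwo_pos hs ht) hli,
      curvatureForm_metricTwo_eq_zero_iff hs ht] at h0
    have hli' : LinearIndependent ℝ ![cheegerTilde projH t X, cheegerTilde projH t Y] := by
      have e : ![cheegerTilde projH t X, cheegerTilde projH t Y]
          = (tildeEquiv ht).toLinearMap ∘ ![X, Y] := by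
        ext i : 1
        fin_cases i <;> rfl
      rw [e]
      exact hli.map' _ (tildeEquiv ht).ker
    obtain ⟨x', y', hs', hn⟩ := h0.exists_normalPair hli'
    obtain ⟨X', rfl⟩ := (tildeEquiv ht).surjective x'
    obtain ⟨Y', rfl⟩ := (tildeEquiv ht).surjective y'
    refine ⟨X', Y', hmap ?_, hn⟩
    rw [← hXY, map_tildeEquiv_span_pair, map_tildeEquiv_span_pair]
    exact hs'.symm
  · rintro ⟨X, Y, rfl, hn : IsNormalPair _ _⟩
    have hspan (X' Y' : sp2) (h : Submodule.span ℝ {X', Y'} = Submodule.span ℝ {X, Y}) :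
        Submodule.span ℝ {cheegerTilde projH t X', cheegerTilde projH t Y'}
          = Submodule.span ℝ {cheegerTilde projH t X, cheegerTilde projH t Y} := by
      rw [← map_tildeEquiv_span_pair ht, h, map_tildeEquiv_span_pair]
    constructor
    · rw [← LinearEquiv.finrank_map_eq (tildeEquiv ht), map_tildeEquiv_span_pair]
      have h1 := linearIndependent_iff_card_eq_finrank_span.1 hn.linearIndependent
      rwa [Set.finrank, Matrix.range_cons_cons_empty, Fintype.card_fin, eq_comm] at h1
    · intro X' Y' h
      have hflat := hn.isFlat.of_span_eq (hspan X' Y' h)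
      have h0 := (curvatureForm_metricTwo_eq_zero_iff hs ht X' Y').2 hflat
      rw [sectionalCurvature, div_eq_zero_iff]
      exact Or.inl h0
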